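/- Let $m\ge 1$ be an integer and $v,\lambda>0$. Let $\theta_1,\theta_2,\dots$ be independent random variables, each $m$-Erlang distributed with parameter $\lambda$ (density $\lambda^m s^{m-1}e^{-\lambda s}/(m-1)!$ on $s>0$). A particle starts at $0$ with velocity $+v$ and reverses its velocity at each of the times $\theta_1+\dots+\theta_n$, $n\ge 1$; thus its position at time $t$ is $$x(t)=v\Big(\sum_{i=1}^{k}(-1)^{i+1}\theta_i+(-1)^k\Big(t-\sum_{i=1}^k\theta_i\Big)\Big),$$ where $k$ is the number of reversals up to time $t$. For $t>0$ let $f_c(t,\cdot)$ be the density of the absolutely continuous part, with respect to Lebesgue measure on $\mathbb R$, of the law of $x(t)$. Then $f_c$ has a version that is continuous on $\{(t,x): t>0,\ t\ne|x/v|\}$, and this version (whose values on that set are uniquely determined) is $2m$ times continuously differentiable there and satisfies, at every point $(t,x)$ with $t>0$ and $t\neq |x/v|$, $$\left(\frac{\partial}{\partial t}-v\frac{\partial}{\partial x}+\lambda\right)^{m}\left(\frac{\partial}{\partial t}+v\frac{\partial}{\partial x}+\lambda\right)^{m}f_c(t,x)-\lambda^{2m}f_c(t,x)=0 .$$ -/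

import Mathlib

open MeasureTheory ProbabilityTheory

noncomputable section

namespace ErlangMotion

/-- The `m`-Erlang distribution with parameter `lam`, i.e. the law on `[0, ∞)` with density
`lam ^ m * x ^ (m - 1) * exp (-lam * x) / (m - 1)!`: the Gamma law of shape `m` and rate `lam`. -/
def erlang (m : ℕ) (lam : ℝ) : Measure ℝ := gammaMeasure (m : ℝ) lam

/-- The epoch of the `n`-th velocity alternation, `θ 0 + ... + θ (n - 1)`; here `θ i` is the time
between the `i`-th and the `(i + 1)`-th alternation (and `θ 0` the time of the first one). -/
def epoch {Ω : Type*} (θ : ℕ → Ω → ℝ) (n : ℕ) (ω : Ω) : ℝ := ∑ i ∈ Finset.range n, θ i ω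

/-- The number of velocity alternations up to time `t`. -/
def alternations {Ω : Type*} (θ : ℕ → Ω → ℝ) (t : ℝ) (ω : Ω) : ℕ :=
  {n : ℕ | 1 ≤ n ∧ epoch θ n ω ≤ t}.ncard

/-- The position at time `t` of the particle that starts at `0` with velocity `+v` and reverses its
velocity at each epoch: the signed lengths of the completed legs, plus the current leg. -/
def position {Ω : Type*} (v : ℝ) (θ : ℕ → Ω → ℝ) (t : ℝ) (ω : Ω) : ℝ :=
  v * (∑ i ∈ Finset.range (alternations θ t ω), (-1) ^ i * θ i ω
    + (-1) ^ alternations θ t ω * (t - epoch θ (alternations θ t ω) ω))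

/-- The points `(t, x)` with `t > 0` off the singular lines `t = x / v` and `t = -x / v`. -/
def offLines (v : ℝ) : Set (ℝ × ℝ) := {p | 0 < p.1 ∧ p.1 ≠ |p.2 / v|}

/-- `fc` is the density of the absolutely continuous part (in the Lebesgue decomposition with
respect to Lebesgue measure) of the laws of `X t`, `t > 0`, in the version that is continuous
off the singular lines. For given `t` a density is determined only almost everywhere;
the continuity pins its values at every point off the lines. -/
structure IsContinuousPart {Ω : Type*} [MeasurableSpace Ω] (P : Measure Ω) (X : ℝ → Ω → ℝ)
    (v : ℝ) (fc : ℝ → ℝ → ℝ) : Prop where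
  density : ∀ t : ℝ, 0 < t →
    (fun x => ((P.map (X t)).rnDeriv volume x).toReal) =ᵐ[volume] fc t
  continuousOn : ContinuousOn (Function.uncurry fc) (offLines v)

/-- The first-order operator `∂/∂t + c ∂/∂x + lam` on functions of `(t, x)`. -/
def transportOp (c lam : ℝ) (u : ℝ → ℝ → ℝ) : ℝ → ℝ → ℝ := fun t x =>
  deriv (fun s => u s x) t + c * deriv (fun y => u t y) x + lam * u t x

end ErlangMotion

end

/-! Use the characteristic coordinates `a = (t + x/v)/2` and `b = (t - x/v)/2`, the times spent
moving forward and backward. If the current leg is the `k`-th, the position depends only on the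
total length `D` of the completed legs run in the opposite direction (`position_eq`). The event that
leg `k` is in progress says that the remaining time `t - D` lies in that leg, once the completed
legs of its own direction are placed end to end. These two groups of legs are independent. So for `k
≥ 1` the law of the position on this event has as density an Erlang density in one characteristic
coordinate times a block of `m` Poisson weights in the other (`measure_sum_mem_cover`,
`measure_legEvent_inter_position`), while `k = 0` gives the atom at `v * t` (`map_position`).

All exponentials combine to `exp (-lam * t)`. Inside the cone the sum over `k` is therefore, up to a
constant, this factor times a double series in divided powers of `lam * a` and `lam * b` with
bounded coefficients `waveCoeff`. Outside the closed cone it is zero (`hasSum_legDensity`).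

The damping cancels the zeroth-order term of the operators, which become `∂/∂a` and `∂/∂b`. Each
multiplies by `lam` and shifts one index of the coefficients. The equation is thus the invariance of
the coefficients under the shift by `(m, m)` (`waveCoeff_add_add`,
`transportOp_iterate_iterate_dampedWave`). Any other continuous version agrees with this one off the
lines (`IsContinuousPart.eq`). -/

namespace ErlangMotion

/-! ### Double exponential series with bounded coefficients. -/

/-- The derivative of the divided power `x ^ n / n!`. -/
noncomputable def divPowDeriv : ℕ → ℝ → ℝ
  | 0, _ => 0
  | n + 1, x => x ^ n / n.factorial

lemma hasDerivAt_divPow (n : ℕ) (x : ℝ) :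
    HasDerivAt (fun y : ℝ => y ^ n / n.factorial) (divPowDeriv n x) x := by
  cases n with
  | zero => simpa [divPowDeriv] using hasDerivAt_const x (1 : ℝ)
  | succ n =>
    refine ((hasDerivAt_pow (n + 1) x).div_const _).congr_deriv ?_
    have h : (n.factorial : ℝ) ≠ 0 := by positivity
    simp only [divPowDeriv, Nat.factorial_succ, Nat.cast_mul, Nat.add_sub_cancel]
    field_simp

lemma summable_divPowDeriv (x : ℝ) : Summable fun n => divPowDeriv n x :=
  (summable_nat_add_iff 1).1 (Real.summable_pow_div_factorial x)

lemma divPowDeriv_nonneg {x : ℝ} (hx : 0 ≤ x) (n : ℕ) : 0 ≤ divPowDeriv n x := by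
  cases n <;> simp only [divPowDeriv] <;> positivity

lemma abs_divPow_le {x R : ℝ} (h : |x| ≤ R) (n : ℕ) :
    |x ^ n / n.factorial| ≤ R ^ n / n.factorial := by
  rw [abs_div, abs_pow, Nat.abs_cast]
  gcongr

lemma abs_divPowDeriv_le {x R : ℝ} (h : |x| ≤ R) (n : ℕ) :
    |divPowDeriv n x| ≤ divPowDeriv n R := by
  cases n with
  | zero => simp [divPowDeriv]
  | succ n => exact abs_divPow_le h n

/-- The exponential generating function of a double sequence. -/
noncomputable def biExp (c : ℕ → ℕ → ℝ) (p : ℝ × ℝ) : ℝ :=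
  ∑' k : ℕ × ℕ, c k.1 k.2 * (p.1 ^ k.1 / k.1.factorial * (p.2 ^ k.2 / k.2.factorial))

lemma summable_of_bounded_coeff {c : ℕ → ℕ → ℝ} {C : ℝ} (hc : ∀ i j, |c i j| ≤ C)
    {f g F G : ℕ → ℝ} (hf : ∀ n, |f n| ≤ F n) (hg : ∀ n, |g n| ≤ G n)
    (hF : Summable F) (hG : Summable G) :
    Summable fun k : ℕ × ℕ => c k.1 k.2 * (f k.1 * g k.2) := by
  have hF0 : ∀ n, 0 ≤ F n := fun n => (abs_nonneg _).trans (hf n)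
  have hG0 : ∀ n, 0 ≤ G n := fun n => (abs_nonneg _).trans (hg n)
  refine Summable.of_norm_bounded ((hF.mul_of_nonneg hG hF0 hG0).mul_left C) fun k => ?_
  rw [Real.norm_eq_abs, abs_mul, abs_mul]
  have hC : 0 ≤ C := (abs_nonneg _).trans (hc 0 0)
  exact mul_le_mul (hc _ _) (mul_le_mul (hf _) (hg _) (abs_nonneg _) (hF0 _))
    (by positivity) hC

lemma summable_biExp {c : ℕ → ℕ → ℝ} {C : ℝ} (hc : ∀ i j, |c i j| ≤ C) (p : ℝ × ℝ) :
    Summable fun k : ℕ × ℕ =>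
      c k.1 k.2 * (p.1 ^ k.1 / k.1.factorial * (p.2 ^ k.2 / k.2.factorial)) :=
  summable_of_bounded_coeff (f := fun n => p.1 ^ n / n.factorial)
    (g := fun n => p.2 ^ n / n.factorial) hc (fun n => abs_divPow_le le_rfl n)
    (fun n => abs_divPow_le le_rfl n) (Real.summable_pow_div_factorial _) (Real.summable_pow_div_factorial _)

/-- Differentiation lowers a divided power by one and kills the zeroth, so reindexing turns it into
a shift of the coefficients. -/
lemma tsum_divPowDeriv_left (c : ℕ → ℕ → ℝ) (p : ℝ × ℝ) :
    ∑' k : ℕ × ℕ, c k.1 k.2 * (divPowDeriv k.1 p.1 * (p.2 ^ k.2 / k.2.factorial)) =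
      biExp (fun i j => c (i + 1) j) p := by
  have hinj : Function.Injective fun k : ℕ × ℕ => (k.1 + 1, k.2) := by
    rintro ⟨a, b⟩ ⟨a', b'⟩ h
    simpa using h
  rw [biExp, ← hinj.tsum_eq]
  · rfl
  · rintro ⟨a, b⟩ h
    cases a with
    | zero => simp [divPowDeriv] at h
    | succ a => exact ⟨(a, b), rfl⟩

lemma tsum_divPowDeriv_right (c : ℕ → ℕ → ℝ) (p : ℝ × ℝ) :
    ∑' k : ℕ × ℕ, c k.1 k.2 * (p.1 ^ k.1 / k.1.factorial * divPowDeriv k.2 p.2) =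
      biExp (fun i j => c i (j + 1)) p := by
  have hinj : Function.Injective fun k : ℕ × ℕ => (k.1, k.2 + 1) := by
    rintro ⟨a, b⟩ ⟨a', b'⟩ h
    simpa using h
  rw [biExp, ← hinj.tsum_eq]
  · rfl
  · rintro ⟨a, b⟩ h
    cases b with
    | zero => simp [divPowDeriv] at h
    | succ b => exact ⟨(a, b), rfl⟩

-- Termwise differentiation under a summable majorant. The partial derivatives are series of the
-- same kind with the same bound `C`, so the argument can be repeated.
open ContinuousLinearMap in
lemma hasFDerivAt_biExp {c : ℕ → ℕ → ℝ} {C : ℝ} (hc : ∀ i j, |c i j| ≤ C) (p : ℝ × ℝ) :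
    HasFDerivAt (biExp c) (biExp (fun i j => c (i + 1) j) p • fst ℝ ℝ ℝ +
      biExp (fun i j => c i (j + 1)) p • snd ℝ ℝ ℝ) p := by
  -- Any radius exceeding `‖p‖` works: on this ball both coordinates are at most `R`, and the series
  -- evaluated at `R` dominate.
  set R : ℝ := ‖p‖ + 1
  have hR : 0 ≤ R := by positivity
  have hC : 0 ≤ C := (abs_nonneg _).trans (hc 0 0)
  have hp : p ∈ Metric.ball (0 : ℝ × ℝ) R := by simp [R]
  have hball : ∀ y ∈ Metric.ball (0 : ℝ × ℝ) R, |y.1| ≤ R ∧ |y.2| ≤ R := fun y hy => by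
    have hy : ‖y‖ < R := by simpa using hy
    exact ⟨(norm_fst_le y).trans hy.le, (norm_snd_le y).trans hy.le⟩
  have hE := Real.summable_pow_div_factorial R
  have hD := summable_divPowDeriv R
  have hE0 : ∀ n : ℕ, 0 ≤ R ^ n / n.factorial := fun n => by positivity
  have hD0 := divPowDeriv_nonneg hR
  have key := hasFDerivAt_tsum_of_isPreconnected (𝕜 := ℝ)
    (f := fun (k : ℕ × ℕ) (y : ℝ × ℝ) =>
      c k.1 k.2 * (y.1 ^ k.1 / k.1.factorial * (y.2 ^ k.2 / k.2.factorial)))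
    (f' := fun k y =>
      (c k.1 k.2 * (divPowDeriv k.1 y.1 * (y.2 ^ k.2 / k.2.factorial))) • fst ℝ ℝ ℝ +
      (c k.1 k.2 * (y.1 ^ k.1 / k.1.factorial * divPowDeriv k.2 y.2)) • snd ℝ ℝ ℝ)
    (u := fun k => C * (divPowDeriv k.1 R * (R ^ k.2 / k.2.factorial)) +
      C * (R ^ k.1 / k.1.factorial * divPowDeriv k.2 R))
    (((hD.mul_of_nonneg hE hD0 hE0).mul_left C).add ((hE.mul_of_nonneg hD hE0 hD0).mul_left C))
    Metric.isOpen_ball (convex_ball _ _).isPreconnected ?_ ?_ hp (summable_biExp hc p) hp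
  · refine key.congr_fderiv ?_
    have h1 := hball p hp
    have s1 := summable_of_bounded_coeff hc (fun n => abs_divPowDeriv_le h1.1 n)
      (fun n => abs_divPow_le h1.2 n) hD hE
    have s2 := summable_of_bounded_coeff hc (fun n => abs_divPow_le h1.1 n)
      (fun n => abs_divPowDeriv_le h1.2 n) hE hD
    rw [(s1.smul_const _).tsum_add (s2.smul_const _), s1.tsum_smul_const, s2.tsum_smul_const,
      tsum_divPowDeriv_left, tsum_divPowDeriv_right]
  · intro k y _
    have h1 := (hasDerivAt_divPow k.1 y.1).comp_hasFDerivAt y (hasFDerivAt_fst (𝕜 := ℝ))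
    have h2 := (hasDerivAt_divPow k.2 y.2).comp_hasFDerivAt y (hasFDerivAt_snd (𝕜 := ℝ))
    refine ((h1.mul h2).const_mul (c k.1 k.2)).congr_fderiv ?_
    ext <;> simp <;> ring_nf <;> simp
  · intro k y hy
    have hy := hball y hy
    refine (norm_add_le _ _).trans (add_le_add ?_ ?_)
    · rw [norm_smul, Real.norm_eq_abs, abs_mul, abs_mul]
      refine (mul_le_of_le_one_right (by positivity) (norm_fst_le ℝ ℝ ℝ)).trans ?_
      exact mul_le_mul (hc _ _) (mul_le_mul (abs_divPowDeriv_le hy.1 _) (abs_divPow_le hy.2 _)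
        (abs_nonneg _) (hD0 _)) (by positivity) hC
    · rw [norm_smul, Real.norm_eq_abs, abs_mul, abs_mul]
      refine (mul_le_of_le_one_right (by positivity) (norm_snd_le ℝ ℝ ℝ)).trans ?_
      exact mul_le_mul (hc _ _) (mul_le_mul (abs_divPow_le hy.1 _) (abs_divPowDeriv_le hy.2 _)
        (abs_nonneg _) (hE0 _)) (by positivity) hC

lemma contDiff_biExp {C : ℝ} (n : ℕ) : ∀ {c : ℕ → ℕ → ℝ}, (∀ i j, |c i j| ≤ C) →
    ContDiff ℝ n (biExp c) := by
  induction n with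
  | zero =>
    intro c hc
    exact contDiff_zero.2 (continuous_iff_continuousAt.2 fun p =>
      (hasFDerivAt_biExp hc p).continuousAt)
  | succ n ih =>
    intro c hc
    rw [Nat.cast_add, Nat.cast_one, contDiff_succ_iff_hasFDerivAt]
    exact ⟨_, ((ih fun i j => hc (i + 1) j).smul contDiff_const).add
      ((ih fun i j => hc i (j + 1)).smul contDiff_const), hasFDerivAt_biExp hc⟩

/-! ### Damped waves and the transport operators. -/

/-- An exponential generating function in the characteristic coordinates, damped at rate `lam`. -/
noncomputable def dampedWave (v lam : ℝ) (c : ℕ → ℕ → ℝ) (t x : ℝ) : ℝ :=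
  Real.exp (-(lam * t)) * biExp c (lam * ((t + x / v) / 2), lam * ((t - x / v) / 2))

lemma contDiff_dampedWave (v lam : ℝ) {c : ℕ → ℕ → ℝ} {C : ℝ} (hc : ∀ i j, |c i j| ≤ C) (n : ℕ) :
    ContDiff ℝ n (Function.uncurry (dampedWave v lam c)) := by
  have h := contDiff_biExp n hc
  unfold dampedWave Function.uncurry
  fun_prop

lemma hasDerivAt_dampedWave_time (v lam : ℝ) {c : ℕ → ℕ → ℝ} {C : ℝ} (hc : ∀ i j, |c i j| ≤ C)
    (t x : ℝ) : HasDerivAt (fun s => dampedWave v lam c s x)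
      (-lam * dampedWave v lam c t x + lam / 2 * (dampedWave v lam (fun i j => c (i + 1) j) t x +
        dampedWave v lam (fun i j => c i (j + 1)) t x)) t := by
  have h1 : HasDerivAt (fun s : ℝ => lam * ((s + x / v) / 2)) (lam / 2) t := by
    refine ((((hasDerivAt_id t).add_const (x / v)).div_const 2).const_mul lam).congr_deriv ?_
    ring
  have h2 : HasDerivAt (fun s : ℝ => lam * ((s - x / v) / 2)) (lam / 2) t := by
    refine ((((hasDerivAt_id t).sub_const (x / v)).div_const 2).const_mul lam).congr_deriv ?_
    ring
  have h3 : HasDerivAt (fun s : ℝ => Real.exp (-(lam * s))) (Real.exp (-(lam * t)) * -lam) t := by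
    refine (((hasDerivAt_id t).const_mul lam).neg.exp).congr_deriv ?_
    simp
  have h4 := (hasFDerivAt_biExp hc _).comp_hasDerivAt t (h1.prodMk h2)
  refine (h3.mul h4).congr_deriv ?_
  simp [dampedWave]
  ring

lemma hasDerivAt_dampedWave_space (v lam : ℝ) {c : ℕ → ℕ → ℝ} {C : ℝ} (hc : ∀ i j, |c i j| ≤ C)
    (t x : ℝ) : HasDerivAt (fun y => dampedWave v lam c t y)
      (lam / (2 * v) * (dampedWave v lam (fun i j => c (i + 1) j) t x -
        dampedWave v lam (fun i j => c i (j + 1)) t x)) x := by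
  have h1 : HasDerivAt (fun y : ℝ => lam * ((t + y / v) / 2)) (lam / (2 * v)) x := by
    refine (((((hasDerivAt_id x).div_const v).const_add t).div_const 2).const_mul
      lam).congr_deriv ?_
    ring
  have h2 : HasDerivAt (fun y : ℝ => lam * ((t - y / v) / 2)) (-(lam / (2 * v))) x := by
    refine (((((hasDerivAt_id x).div_const v).const_sub t).div_const 2).const_mul
      lam).congr_deriv ?_
    ring
  have h4 := (hasFDerivAt_biExp hc _).comp_hasDerivAt x (h1.prodMk h2)
  refine (h4.const_mul (Real.exp (-(lam * t)))).congr_deriv ?_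
  simp [dampedWave]
  ring

lemma transportOp_const_mul (c lam K : ℝ) (u : ℝ → ℝ → ℝ) :
    transportOp c lam (fun t x => K * u t x) = fun t x => K * transportOp c lam u t x := by
  funext t x
  simp only [transportOp, deriv_const_mul_field]
  ring

/-- The derivative of the damping factor cancels the zeroth-order term. What remains is the
derivative along the first characteristic coordinate. -/
lemma transportOp_dampedWave {v : ℝ} (hv : v ≠ 0) (lam : ℝ) {c : ℕ → ℕ → ℝ} {C : ℝ}
    (hc : ∀ i j, |c i j| ≤ C) : transportOp v lam (dampedWave v lam c) =
      fun t x => lam * dampedWave v lam (fun i j => c (i + 1) j) t x := by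
  funext t x
  rw [transportOp, (hasDerivAt_dampedWave_time v lam hc t x).deriv,
    (hasDerivAt_dampedWave_space v lam hc t x).deriv]
  field_simp
  ring

lemma transportOp_neg_dampedWave {v : ℝ} (hv : v ≠ 0) (lam : ℝ) {c : ℕ → ℕ → ℝ} {C : ℝ}
    (hc : ∀ i j, |c i j| ≤ C) : transportOp (-v) lam (dampedWave v lam c) =
      fun t x => lam * dampedWave v lam (fun i j => c i (j + 1)) t x := by
  funext t x
  rw [transportOp, (hasDerivAt_dampedWave_time v lam hc t x).deriv,
    (hasDerivAt_dampedWave_space v lam hc t x).deriv]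
  field_simp
  ring

lemma transportOp_iterate_const_mul (c lam K : ℝ) (u : ℝ → ℝ → ℝ) (n : ℕ) :
    (transportOp c lam)^[n] (fun t x => K * u t x) =
      fun t x => K * (transportOp c lam)^[n] u t x := by
  induction n generalizing u with
  | zero => rfl
  | succ n ih =>
    rw [Function.iterate_succ_apply, transportOp_const_mul, ih, ← Function.iterate_succ_apply]

lemma transportOp_iterate_dampedWave {v : ℝ} (hv : v ≠ 0) (lam : ℝ) {C : ℝ} (n : ℕ)
    {c : ℕ → ℕ → ℝ} (hc : ∀ i j, |c i j| ≤ C) :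
    (transportOp v lam)^[n] (dampedWave v lam c) =
      fun t x => lam ^ n * dampedWave v lam (fun i j => c (i + n) j) t x := by
  induction n with
  | zero => simp
  | succ n ih =>
    rw [Function.iterate_succ_apply', ih, transportOp_const_mul,
      transportOp_dampedWave hv lam fun i j => hc (i + n) j]
    funext t x
    simp only [pow_succ, mul_assoc, add_right_comm, add_assoc]

lemma transportOp_neg_iterate_dampedWave {v : ℝ} (hv : v ≠ 0) (lam : ℝ) {C : ℝ} (n : ℕ)
    {c : ℕ → ℕ → ℝ} (hc : ∀ i j, |c i j| ≤ C) :
    (transportOp (-v) lam)^[n] (dampedWave v lam c) =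
      fun t x => lam ^ n * dampedWave v lam (fun i j => c i (j + n)) t x := by
  induction n with
  | zero => simp
  | succ n ih =>
    rw [Function.iterate_succ_apply', ih, transportOp_const_mul,
      transportOp_neg_dampedWave hv lam fun i j => hc i (j + n)]
    funext t x
    simp only [pow_succ, mul_assoc, add_assoc, add_comm 1 n]

/-- The `2 * m` operators shift the coefficients by `(m, m)` in total, which `hper` undoes, and each
contributes a factor `lam`. -/
lemma transportOp_iterate_iterate_dampedWave {v : ℝ} (hv : v ≠ 0) (lam : ℝ) {C : ℝ} (m : ℕ)
    {c : ℕ → ℕ → ℝ} (hc : ∀ i j, |c i j| ≤ C) (hper : ∀ i j, c (i + m) (j + m) = c i j) :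
    (transportOp (-v) lam)^[m] ((transportOp v lam)^[m] (dampedWave v lam c)) =
      fun t x => lam ^ (2 * m) * dampedWave v lam c t x := by
  rw [transportOp_iterate_dampedWave hv lam m hc, transportOp_iterate_const_mul,
    transportOp_neg_iterate_dampedWave hv lam m fun i j => hc (i + m) j]
  simp only [hper]
  funext t x
  ring

/-- Locality of the operator. The conclusion holds on all of the open set again, so it passes to
iterates. -/
lemma transportOp_eqOn {c lam : ℝ} {u w : ℝ → ℝ → ℝ} {U : Set (ℝ × ℝ)} (hU : IsOpen U)
    (h : ∀ t x, (t, x) ∈ U → u t x = w t x) :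
    ∀ t x, (t, x) ∈ U → transportOp c lam u t x = transportOp c lam w t x := by
  intro t x htx
  have h1 : (fun s => u s x) =ᶠ[nhds t] fun s => w s x := by
    filter_upwards [(hU.preimage (by fun_prop : Continuous fun s : ℝ => (s, x))).mem_nhds htx]
      with s hs using h s x hs
  have h2 : (fun y => u t y) =ᶠ[nhds x] fun y => w t y := by
    filter_upwards [(hU.preimage (by fun_prop : Continuous fun y : ℝ => (t, y))).mem_nhds htx]
      with y hy using h t y hy
  rw [transportOp, transportOp, h1.deriv_eq, h2.deriv_eq, h t x htx]

lemma transportOp_iterate_eqOn {c lam : ℝ} {U : Set (ℝ × ℝ)} (hU : IsOpen U) (n : ℕ)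
    {u w : ℝ → ℝ → ℝ} (h : ∀ t x, (t, x) ∈ U → u t x = w t x) :
    ∀ t x, (t, x) ∈ U → (transportOp c lam)^[n] u t x = (transportOp c lam)^[n] w t x := by
  induction n generalizing u w with
  | zero => exact h
  | succ n ih => exact ih (transportOp_eqOn hU h)


/-! ### Poisson weights and Erlang laws. -/

/-- The probability that a Poisson variable of mean `y` equals `i`. -/
noncomputable def poissonWeight (i : ℕ) (y : ℝ) : ℝ := Real.exp (-y) * (y ^ i / i.factorial)

@[fun_prop]
lemma continuous_poissonWeight (i : ℕ) : Continuous (poissonWeight i) := by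
  unfold poissonWeight; fun_prop

lemma poissonWeight_nonneg {y : ℝ} (hy : 0 ≤ y) (i : ℕ) : 0 ≤ poissonWeight i y := by
  unfold poissonWeight; positivity

lemma hasDerivAt_poissonWeight (i : ℕ) (y : ℝ) :
    HasDerivAt (poissonWeight i) (Real.exp (-y) * divPowDeriv i y - poissonWeight i y) y := by
  refine ((hasDerivAt_neg y).exp.mul (hasDerivAt_divPow i y)).congr_deriv ?_
  rw [poissonWeight]
  ring

/-- The derivative of each weight is the previous weight minus itself, so the sum telescopes. -/
lemma hasDerivAt_sum_poissonWeight (n : ℕ) (y : ℝ) :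
    HasDerivAt (fun z => ∑ i ∈ Finset.range (n + 1), poissonWeight i z)
      (-poissonWeight n y) y := by
  induction n with
  | zero => simpa [divPowDeriv] using hasDerivAt_poissonWeight 0 y
  | succ n ih =>
    simp_rw [Finset.sum_range_succ _ (n + 1)]
    refine (ih.add (hasDerivAt_poissonWeight (n + 1) y)).congr_deriv ?_
    simp only [poissonWeight, divPowDeriv]
    ring

/-- The density of the Erlang law of shape `n + 1`. -/
noncomputable def erlangDensity (n : ℕ) (lam x : ℝ) : ℝ :=
  if 0 ≤ x then lam * poissonWeight n (lam * x) else 0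

@[fun_prop]
lemma measurable_erlangDensity (n : ℕ) (lam : ℝ) : Measurable (erlangDensity n lam) :=
  Measurable.ite measurableSet_Ici (by fun_prop) measurable_const

lemma gammaPDF_eq_erlangDensity (n : ℕ) (lam x : ℝ) :
    gammaPDF ((n + 1 : ℕ) : ℝ) lam x = ENNReal.ofReal (erlangDensity n lam x) := by
  rw [gammaPDF_eq, erlangDensity]
  congr 2
  rw [Nat.cast_add_one, Real.Gamma_nat_eq_factorial, add_sub_cancel_right, Real.rpow_natCast,
    ← Nat.cast_add_one, Real.rpow_natCast, poissonWeight]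
  ring

lemma erlang_eq_withDensity (n : ℕ) (lam : ℝ) :
    erlang (n + 1) lam =
      volume.withDensity fun x => ENNReal.ofReal (erlangDensity n lam x) := by
  rw [erlang, gammaMeasure]
  congr 1
  funext x
  exact gammaPDF_eq_erlangDensity n lam x

lemma isProbabilityMeasure_erlang {n : ℕ} (hn : 1 ≤ n) {lam : ℝ} (hlam : 0 < lam) :
    IsProbabilityMeasure (erlang n lam) :=
  isProbabilityMeasure_gammaMeasure (by exact_mod_cast hn) hlam

lemma integral_pow_div_factorial (n : ℕ) (x : ℝ) :
    ∫ y in (0 : ℝ)..x, y ^ n / n.factorial = x ^ (n + 1) / (n + 1).factorial := by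
  have h := intervalIntegral.integral_eq_sub_of_hasDerivAt (a := 0) (b := x)
    (fun y _ => hasDerivAt_divPow (n + 1) y)
    ((by fun_prop : Continuous fun y : ℝ => y ^ n / n.factorial).intervalIntegrable _ _)
  simpa [divPowDeriv] using h

/-- The two exponentials multiply to `exp (-(lam * x))`, which does not depend on `y`. Only a
divided power is left to integrate over `[0, x]`. -/
lemma lintegral_erlangDensity_mul (n : ℕ) {lam : ℝ} (hlam : 0 < lam) (x : ℝ) :
    ∫⁻ y, ENNReal.ofReal (erlangDensity n lam y) * ENNReal.ofReal (erlangDensity 0 lam (-y + x)) =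
      ENNReal.ofReal (erlangDensity (n + 1) lam x) := by
  have hpt : ∀ y, ENNReal.ofReal (erlangDensity n lam y) *
      ENNReal.ofReal (erlangDensity 0 lam (-y + x)) = (Set.Icc 0 x).indicator (fun y =>
        ENNReal.ofReal (lam ^ (n + 2) * Real.exp (-(lam * x)) * (y ^ n / n.factorial))) y := by
    intro y
    by_cases hy : y ∈ Set.Icc 0 x
    · rw [Set.indicator_of_mem hy, erlangDensity, erlangDensity, if_pos hy.1,
        if_pos (by linarith [hy.2]), ← ENNReal.ofReal_mul
          (mul_nonneg hlam.le (poissonWeight_nonneg (mul_nonneg hlam.le hy.1) _))]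
      congr 1
      have : Real.exp (-(lam * x)) = Real.exp (-(lam * y)) * Real.exp (-(lam * (-y + x))) := by
        rw [← Real.exp_add]; congr 1; ring
      simp only [this, poissonWeight, mul_pow, pow_zero, Nat.factorial_zero, Nat.cast_one]
      ring
    · rw [Set.indicator_of_notMem hy]
      by_cases h0 : 0 ≤ y
      · rw [erlangDensity, erlangDensity, if_neg (fun h => hy ⟨h0, by linarith⟩ :
          ¬ 0 ≤ -y + x), ENNReal.ofReal_zero, mul_zero]
      · rw [erlangDensity, if_neg h0, ENNReal.ofReal_zero, zero_mul]
  simp_rw [hpt]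
  rw [lintegral_indicator measurableSet_Icc]
  by_cases hx : 0 ≤ x
  · rw [← ofReal_integral_eq_lintegral_ofReal]
    · rw [integral_Icc_eq_integral_Ioc, ← intervalIntegral.integral_of_le hx,
        intervalIntegral.integral_const_mul, integral_pow_div_factorial, erlangDensity, if_pos hx,
        poissonWeight]
      congr 1
      ring
    · exact (Continuous.continuousOn (by fun_prop)).integrableOn_Icc
    · refine (ae_restrict_iff' measurableSet_Icc).2 (ae_of_all _ fun y hy => ?_)
      have := hy.1
      simp only [Pi.zero_apply]
      positivity
  · rw [Set.Icc_eq_empty hx, erlangDensity, if_neg hx]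
    simp

lemma erlang_conv_one (n : ℕ) {lam : ℝ} (hlam : 0 < lam) :
    (erlang (n + 1) lam).conv (erlang 1 lam) = erlang (n + 2) lam := by
  rw [erlang_eq_withDensity n, show (1 : ℕ) = 0 + 1 from rfl, erlang_eq_withDensity 0,
    show n + 2 = (n + 1) + 1 from rfl, erlang_eq_withDensity (n + 1),
    conv_withDensity_eq_lconvolution (by fun_prop) (by fun_prop)]
  congr 1
  funext x
  exact lintegral_erlangDensity_mul n hlam x

/-- Associativity of convolution reduces this to adding one exponential variable at a time. -/
lemma erlang_conv {lam : ℝ} (hlam : 0 < lam) {n k : ℕ} (hn : 1 ≤ n) (hk : 1 ≤ k) :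
    (erlang n lam).conv (erlang k lam) = erlang (n + k) lam := by
  have hfin : ∀ j, 1 ≤ j → IsProbabilityMeasure (erlang j lam) := fun j hj =>
    isProbabilityMeasure_erlang hj hlam
  obtain ⟨n, rfl⟩ := Nat.exists_eq_add_of_le' hn
  induction k, hk using Nat.le_induction with
  | base => exact erlang_conv_one n hlam
  | succ k hk ih =>
    obtain ⟨j, rfl⟩ := Nat.exists_eq_add_of_le' hk
    have := hfin (n + 1) hn
    have := hfin (j + 1) hk
    have := hfin 1 le_rfl
    rw [show j + 1 + 1 = j + 2 from rfl, ← erlang_conv_one j hlam, ← Measure.conv_assoc, ih,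
      show n + 1 + (j + 1) = (n + j + 1) + 1 by ring, erlang_conv_one _ hlam]
    congr 1
    ring

lemma erlang_Iic_zero {n : ℕ} (hn : 1 ≤ n) (lam : ℝ) : erlang n lam (Set.Iic 0) = 0 := by
  obtain ⟨n, rfl⟩ := Nat.exists_eq_add_of_le' hn
  rw [erlang, gammaMeasure, withDensity_apply _ measurableSet_Iic,
    setLIntegral_congr (Iio_ae_eq_Iic (μ := volume)).symm, lintegral_gammaPDF_of_nonpos le_rfl]

/-- Gamma–Poisson duality: minus the partial Poisson sum is an antiderivative of the density. -/
lemma erlang_Iic (n : ℕ) {lam : ℝ} (hlam : 0 < lam) {u : ℝ} (hu : 0 ≤ u) :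
    erlang (n + 1) lam (Set.Iic u) =
      ENNReal.ofReal (1 - ∑ i ∈ Finset.range (n + 1), poissonWeight i (lam * u)) := by
  have hsplit : Set.Iic u = Set.Iic 0 ∪ Set.Ioc 0 u := (Set.Iic_union_Ioc_eq_Iic hu).symm
  rw [hsplit, measure_union (Set.Iic_disjoint_Ioc le_rfl) measurableSet_Ioc,
    erlang_Iic_zero (Nat.le_add_left 1 n), zero_add, erlang_eq_withDensity,
    withDensity_apply _ measurableSet_Ioc]
  have hd : ∀ y : ℝ, HasDerivAt
      (fun z => -∑ i ∈ Finset.range (n + 1), poissonWeight i (lam * z))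
      (lam * poissonWeight n (lam * y)) y := fun y => by
    refine (((hasDerivAt_sum_poissonWeight n (lam * y)).comp y
      ((hasDerivAt_id y).const_mul lam)).neg).congr_deriv ?_
    simp
    ring
  rw [setLIntegral_congr_fun (g := fun y => ENNReal.ofReal (lam * poissonWeight n (lam * y)))
    measurableSet_Ioc fun y hy => by simp only [erlangDensity, if_pos hy.1.le],
    ← ofReal_integral_eq_lintegral_ofReal, ← intervalIntegral.integral_of_le hu,
    intervalIntegral.integral_eq_sub_of_hasDerivAt fun y _ => hd y]
  · congr 1
    rw [Finset.sum_range_succ' (fun i => poissonWeight i (lam * 0))]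
    simp [poissonWeight]
    ring
  · exact Continuous.intervalIntegrable (by fun_prop) _ _
  · exact ((Continuous.continuousOn (by fun_prop)).integrableOn_Icc).mono_set
      Set.Ioc_subset_Icc_self
  · refine (ae_restrict_iff' measurableSet_Ioc).2 (ae_of_all _ fun y hy => ?_)
    exact mul_nonneg hlam.le (poissonWeight_nonneg (mul_nonneg hlam.le hy.1.le) _)


/-! ### Sums of independent legs. -/

/-- The probability that, for `u ≥ 0`, a point `u` is covered by an `m`-Erlang interval that starts
at an independent Erlang time of shape `q * m`. -/
noncomputable def coverWeight (m : ℕ) (lam : ℝ) (q : ℕ) (u : ℝ) : ℝ :=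
  if 0 ≤ u then ∑ i ∈ Finset.range m, poissonWeight (q * m + i) (lam * u) else 0

@[fun_prop]
lemma measurable_coverWeight (m : ℕ) (lam : ℝ) (q : ℕ) : Measurable (coverWeight m lam q) :=
  Measurable.ite measurableSet_Ici (by fun_prop) measurable_const

lemma sum_poissonWeight_le_one (n : ℕ) {y : ℝ} (hy : 0 ≤ y) :
    ∑ i ∈ Finset.range n, poissonWeight i y ≤ 1 := by
  simp only [poissonWeight, ← Finset.mul_sum]
  calc Real.exp (-y) * ∑ i ∈ Finset.range n, y ^ i / i.factorial
      ≤ Real.exp (-y) * Real.exp y := by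
        gcongr
        exact Real.sum_le_exp_of_nonneg hy n
    _ = 1 := by rw [← Real.exp_add]; simp

lemma hasSum_poissonWeight (y : ℝ) : HasSum (fun i => poissonWeight i y) 1 := by
  have h := (NormedSpace.expSeries_div_hasSum_exp y).mul_left (Real.exp (-y))
  rw [← Real.exp_eq_exp_ℝ, ← Real.exp_add] at h
  simpa [poissonWeight] using h

section Sums

variable {Ω : Type*} [MeasurableSpace Ω] {P : Measure Ω} {m : ℕ}
  {lam : ℝ} {θ : ℕ → Ω → ℝ}

lemma hasLaw_sum_erlang (hm : 1 ≤ m) (hlam : 0 < lam) (hmeas : ∀ i, Measurable (θ i))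
    (hindep : iIndepFun θ P) (hlaw : ∀ i, HasLaw (θ i) (erlang m lam) P) {S : Finset ℕ}
    (hS : S.Nonempty) : HasLaw (fun ω => ∑ i ∈ S, θ i ω) (erlang (S.card * m) lam) P := by
  induction hS using Finset.Nonempty.cons_induction with
  | singleton a => simpa using hlaw a
  | cons a S ha hS ih =>
    have hS1 : 1 ≤ S.card * m := Nat.mul_pos hS.card_pos hm
    have := isProbabilityMeasure_erlang hm hlam
    have := isProbabilityMeasure_erlang hS1 hlam
    have hi := hindep.indepFun_finsetSum_of_notMem hmeas ha
    have hadd := IndepFun.hasLaw_fun_add (X := fun ω => ∑ i ∈ S, θ i ω) (Y := θ a) ih (hlaw a)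
      (by simpa [Finset.sum_fn] using hi)
    rw [erlang_conv hlam hS1 hm] at hadd
    simp only [Finset.sum_cons, Finset.card_cons, add_mul, one_mul]
    simpa only [add_comm] using hadd

lemma ae_pos (hm : 1 ≤ m) (hlaw : ∀ i, HasLaw (θ i) (erlang m lam) P) :
    ∀ᵐ ω ∂P, ∀ i, 0 < θ i ω := by
  refine ae_all_iff.2 fun i => ?_
  have h : ∀ᵐ x ∂erlang m lam, 0 < x := by
    rw [ae_iff]
    simpa [Set.Iic] using erlang_Iic_zero hm lam
  rw [← (hlaw i).map_eq] at h
  exact ae_of_ae_map (hlaw i).aemeasurable h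

lemma measure_sum_le [IsProbabilityMeasure P] (hm : 1 ≤ m) (hlam : 0 < lam)
    (hmeas : ∀ i, Measurable (θ i))
    (hindep : iIndepFun θ P) (hlaw : ∀ i, HasLaw (θ i) (erlang m lam) P) (S : Finset ℕ)
    {u : ℝ} (hu : 0 ≤ u) : P {ω | ∑ i ∈ S, θ i ω ≤ u} =
      ENNReal.ofReal (1 - ∑ i ∈ Finset.range (S.card * m), poissonWeight i (lam * u)) := by
  rcases S.eq_empty_or_nonempty with rfl | hS
  · simp [hu]
  · have hS1 : 1 ≤ S.card * m := Nat.mul_pos hS.card_pos hm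
    rw [(hasLaw_sum_erlang hm hlam hmeas hindep hlaw hS).measure_eq (p := fun x => x ≤ u)
      measurableSet_Iic]
    obtain ⟨n, hn⟩ := Nat.exists_eq_add_of_le' hS1
    rw [hn]
    exact erlang_Iic n hlam hu

/-- Almost surely the event is the difference of two nested events, that the sums over `T` and over
`insert c T` are at most `u`. The shapes differ by `m`, so the Poisson sums differ by one block of
`m` weights. -/
lemma measure_cover [IsProbabilityMeasure P] (hm : 1 ≤ m) (hlam : 0 < lam)
    (hmeas : ∀ i, Measurable (θ i))
    (hindep : iIndepFun θ P) (hlaw : ∀ i, HasLaw (θ i) (erlang m lam) P) {T : Finset ℕ}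
    {c : ℕ} (hc : c ∉ T) (u : ℝ) :
    P {ω | ∑ i ∈ T, θ i ω ≤ u ∧ u < ∑ i ∈ T, θ i ω + θ c ω} =
      ENNReal.ofReal (coverWeight m lam T.card u) := by
  by_cases hu : 0 ≤ u
  · have hadd : P {ω | ∑ i ∈ insert c T, θ i ω ≤ u} +
        P {ω | ∑ i ∈ T, θ i ω ≤ u ∧ u < ∑ i ∈ T, θ i ω + θ c ω} =
        P {ω | ∑ i ∈ T, θ i ω ≤ u} := by
      rw [← measure_inter_add_sdiff {ω | ∑ i ∈ T, θ i ω ≤ u}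
        (measurableSet_le (by fun_prop) measurable_const :
          MeasurableSet {ω | ∑ i ∈ insert c T, θ i ω ≤ u})]
      congr 1
      · refine measure_congr ?_
        filter_upwards [ae_pos hm hlaw] with ω hω
        refine propext ⟨fun h => ⟨?_, h⟩, fun h => h.2⟩
        have h : ∑ i ∈ insert c T, θ i ω ≤ u := h
        rw [Finset.sum_insert hc] at h
        show ∑ i ∈ T, θ i ω ≤ u
        linarith [hω c]
      · congr 1
        ext ω
        simp only [Set.mem_ofPred_eq, Set.mem_sdiff, Finset.sum_insert hc, not_le, add_comm]
    rw [measure_sum_le hm hlam hmeas hindep hlaw _ hu,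
      measure_sum_le hm hlam hmeas hindep hlaw _ hu, Finset.card_insert_of_notMem hc] at hadd
    rw [ENNReal.eq_sub_of_add_eq' ENNReal.ofReal_ne_top ((add_comm _ _).trans hadd),
      ← ENNReal.ofReal_sub _ (sub_nonneg.2 (sum_poissonWeight_le_one _ (mul_nonneg hlam.le hu))),
      coverWeight, if_pos hu, add_mul, one_mul, Finset.sum_range_add]
    congr 1
    ring
  · rw [coverWeight, if_neg hu, ENNReal.ofReal_zero]
    refine measure_eq_zero_iff_ae_notMem.2 ?_
    filter_upwards [ae_pos hm hlaw] with ω hω h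
    exact hu ((Finset.sum_nonneg fun i _ => (hω i).le).trans h.1)

lemma indepFun_sum_prodMk (hmeas : ∀ i, Measurable (θ i)) (hindep : iIndepFun θ P)
    {S T : Finset ℕ} {c : ℕ} (hST : Disjoint S T) (hcS : c ∉ S) :
    IndepFun (fun ω => ∑ i ∈ S, θ i ω) (fun ω => (∑ i ∈ T, θ i ω, θ c ω)) P := by
  have hd : Disjoint S (insert c T) := Finset.disjoint_insert_right.2 ⟨hcS, hST⟩
  have h := (hindep.indepFun_finset S (insert c T) hd hmeas).comp
    (φ := fun f : {x // x ∈ S} → ℝ => ∑ i, f i)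
    (ψ := fun f : {x // x ∈ insert c T} → ℝ =>
      (∑ i : {x // x ∈ T}, f ⟨i.1, Finset.mem_insert_of_mem i.2⟩,
        f ⟨c, Finset.mem_insert_self c T⟩))
    (by fun_prop) (by fun_prop)
  convert h using 1
  · funext ω
    exact (Finset.sum_coe_sort S fun i => θ i ω).symm
  · funext ω
    exact Prod.ext (Finset.sum_coe_sort T fun i => θ i ω).symm rfl

/-- Condition on the value `d` of the sum over `S`: by independence the remaining probability is
`measure_cover` at `t - d`. Nonemptiness of `S` gives this sum a density. -/
lemma measure_sum_mem_cover [IsProbabilityMeasure P] (hm : 1 ≤ m) (hlam : 0 < lam)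
    (hmeas : ∀ i, Measurable (θ i))
    (hindep : iIndepFun θ P) (hlaw : ∀ i, HasLaw (θ i) (erlang m lam) P) {S T : Finset ℕ} {c : ℕ}
    (hS : S.Nonempty) (hST : Disjoint S T) (hcS : c ∉ S) (hcT : c ∉ T) (t : ℝ) {B : Set ℝ}
    (hB : MeasurableSet B) :
    P {ω | ∑ i ∈ S, θ i ω ∈ B ∧ ∑ i ∈ T, θ i ω ≤ t - ∑ i ∈ S, θ i ω ∧
        t - ∑ i ∈ S, θ i ω < ∑ i ∈ T, θ i ω + θ c ω} =
      ∫⁻ d, B.indicator (fun d => ENNReal.ofReal (erlangDensity (S.card * m - 1) lam d) *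
        ENNReal.ofReal (coverWeight m lam T.card (t - d))) d := by
  have hS1 : 1 ≤ S.card * m := Nat.mul_pos hS.card_pos hm
  have hD : Measurable fun ω => ∑ i ∈ S, θ i ω := by fun_prop
  have hO : Measurable fun ω => (∑ i ∈ T, θ i ω, θ c ω) := by fun_prop
  have hA : MeasurableSet {p : ℝ × ℝ × ℝ | p.1 ∈ B ∧ p.2.1 ≤ t - p.1 ∧
      t - p.1 < p.2.1 + p.2.2} :=
    (measurable_fst hB).inter ((measurableSet_le (f := fun p : ℝ × ℝ × ℝ => p.2.1)
      (g := fun p => t - p.1) (by fun_prop) (by fun_prop)).inter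
      (measurableSet_lt (f := fun p : ℝ × ℝ × ℝ => t - p.1) (g := fun p => p.2.1 + p.2.2)
        (by fun_prop) (by fun_prop)))
  have hprod := (indepFun_iff_map_prod_eq_prod_map_map hD.aemeasurable hO.aemeasurable).1
    (indepFun_sum_prodMk hmeas hindep hST hcS)
  have h1 : P {ω | ∑ i ∈ S, θ i ω ∈ B ∧ ∑ i ∈ T, θ i ω ≤ t - ∑ i ∈ S, θ i ω ∧
        t - ∑ i ∈ S, θ i ω < ∑ i ∈ T, θ i ω + θ c ω} =
      P.map (fun ω => (∑ i ∈ S, θ i ω, (∑ i ∈ T, θ i ω, θ c ω))) {p : ℝ × ℝ × ℝ |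
        p.1 ∈ B ∧ p.2.1 ≤ t - p.1 ∧ t - p.1 < p.2.1 + p.2.2} := by
    rw [Measure.map_apply (hD.prodMk hO) hA]
    rfl
  have := Measure.isProbabilityMeasure_map (μ := P) hO.aemeasurable
  rw [h1, hprod, Measure.prod_apply hA,
    (hasLaw_sum_erlang hm hlam hmeas hindep hlaw hS).map_eq]
  have h2 : ∀ d, P.map (fun ω => (∑ i ∈ T, θ i ω, θ c ω)) (Prod.mk d ⁻¹' {p : ℝ × ℝ × ℝ |
      p.1 ∈ B ∧ p.2.1 ≤ t - p.1 ∧ t - p.1 < p.2.1 + p.2.2}) =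
      B.indicator (fun d => ENNReal.ofReal (coverWeight m lam T.card (t - d))) d := fun d => by
    rw [Measure.map_apply hO (measurable_prodMk_left hA)]
    by_cases hd : d ∈ B
    · rw [Set.indicator_of_mem hd, ← measure_cover hm hlam hmeas hindep hlaw hcT]
      congr 1
      ext ω
      simp [hd]
    · simp [hd]
  simp_rw [h2]
  obtain ⟨n, hn⟩ := Nat.exists_eq_add_of_le' hS1
  rw [hn, Nat.add_sub_cancel, erlang_eq_withDensity,
    lintegral_withDensity_eq_lintegral_mul _ (by fun_prop) (Measurable.indicator (by fun_prop) hB)]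
  refine lintegral_congr fun d => ?_
  by_cases hd : d ∈ B <;> simp [hd]

end Sums


/-! ### Legs by direction, and the path up to a fixed time. -/

/-- The indices below `k` of the parity of `k`. -/
def likeLegs (k : ℕ) : Finset ℕ := (Finset.range k).filter fun i => i % 2 = k % 2

/-- The indices below `k` of the parity opposite to that of `k`. -/
def unlikeLegs (k : ℕ) : Finset ℕ := (Finset.range k).filter fun i => ¬ i % 2 = k % 2

lemma likeLegs_succ (k : ℕ) : likeLegs (k + 1) = unlikeLegs k := by
  ext i
  simp only [likeLegs, unlikeLegs, Finset.mem_filter, Finset.mem_range]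
  omega

lemma unlikeLegs_succ (k : ℕ) : unlikeLegs (k + 1) = insert k (likeLegs k) := by
  ext i
  simp only [likeLegs, unlikeLegs, Finset.mem_filter, Finset.mem_range, Finset.mem_insert]
  omega

lemma notMem_likeLegs (k : ℕ) : k ∉ likeLegs k := by simp [likeLegs]

lemma notMem_unlikeLegs (k : ℕ) : k ∉ unlikeLegs k := by simp [unlikeLegs]

lemma disjoint_legs (k : ℕ) : Disjoint (unlikeLegs k) (likeLegs k) :=
  (Finset.disjoint_filter_filter_not _ _ _).symm

lemma card_legs (k : ℕ) : (likeLegs k).card = k / 2 ∧ (unlikeLegs k).card = (k + 1) / 2 := by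
  induction k with
  | zero => simp [likeLegs, unlikeLegs]
  | succ k ih =>
    rw [likeLegs_succ, unlikeLegs_succ, Finset.card_insert_of_notMem (notMem_likeLegs k), ih.1,
      ih.2]
    omega

lemma sum_legs (k : ℕ) (f : ℕ → ℝ) :
    ∑ i ∈ likeLegs k, f i + ∑ i ∈ unlikeLegs k, f i = ∑ i ∈ Finset.range k, f i :=
  Finset.sum_filter_add_sum_filter_not _ _ _

lemma alternating_sum_legs (k : ℕ) (f : ℕ → ℝ) : ∑ i ∈ Finset.range k, (-1) ^ i * f i =
    (-1) ^ k * (∑ i ∈ likeLegs k, f i - ∑ i ∈ unlikeLegs k, f i) := by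
  induction k with
  | zero => simp [likeLegs, unlikeLegs]
  | succ k ih =>
    rw [Finset.sum_range_succ, ih, likeLegs_succ, unlikeLegs_succ,
      Finset.sum_insert (notMem_likeLegs k)]
    ring

section Paths

variable {Ω : Type*} {θ : ℕ → Ω → ℝ} {ω : Ω} {t : ℝ}

lemma strictMono_epoch (hpos : ∀ i, 0 < θ i ω) : StrictMono fun n => epoch θ n ω :=
  strictMono_nat_of_lt_succ fun n => by
    simp only [epoch, Finset.sum_range_succ]
    linarith [hpos n]

lemma alternations_eq (hpos : ∀ i, 0 < θ i ω) {k : ℕ} (h1 : epoch θ k ω ≤ t)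
    (h2 : t < epoch θ (k + 1) ω) : alternations θ t ω = k := by
  have hmono := strictMono_epoch hpos
  have : {n : ℕ | 1 ≤ n ∧ epoch θ n ω ≤ t} = (Finset.Icc 1 k : Finset ℕ) := by
    ext n
    simp only [Set.mem_ofPred_eq, Finset.coe_Icc, Set.mem_Icc]
    refine and_congr_right fun _ => ⟨fun h => ?_, fun h => (hmono.monotone h).trans h1⟩
    exact Nat.lt_succ_iff.1 (hmono.lt_iff_lt.1 (h.trans_lt h2))
  rw [alternations, this, Set.ncard_coe_finset, Nat.card_Icc, Nat.add_sub_cancel]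

/-- Relative to the current direction, displacement is the elapsed time minus twice the time spent
moving the other way. All of the latter lies in completed legs. -/
lemma position_eq (v : ℝ) (hpos : ∀ i, 0 < θ i ω) {k : ℕ} (h1 : epoch θ k ω ≤ t)
    (h2 : t < epoch θ (k + 1) ω) :
    position v θ t ω = (-1) ^ k * v * (t - 2 * ∑ i ∈ unlikeLegs k, θ i ω) := by
  rw [position, alternations_eq hpos h1 h2, alternating_sum_legs, epoch, ← sum_legs]
  ring

lemma exists_epoch_le_lt (ht : 0 ≤ t) (h : ∃ n, t < epoch θ n ω) :
    ∃ k, epoch θ k ω ≤ t ∧ t < epoch θ (k + 1) ω := by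
  classical
  have h0 : Nat.find h ≠ 0 := fun h0 => by
    have := Nat.find_spec h
    rw [h0] at this
    simp only [epoch, Finset.range_zero, Finset.sum_empty] at this
    linarith
  obtain ⟨k, hk⟩ := Nat.exists_eq_succ_of_ne_zero h0
  refine ⟨k, not_lt.1 (Nat.find_min h (by omega)), ?_⟩
  have := Nat.find_spec h
  rwa [hk] at this

end Paths

/-! ### The law of the position, split by the number of alternations. -/

/-- The event that exactly `k` velocity alternations happen up to time `t`. -/
def legEvent {Ω : Type*} (θ : ℕ → Ω → ℝ) (t : ℝ) (k : ℕ) : Set Ω :=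
  {ω | epoch θ k ω ≤ t ∧ t < epoch θ (k + 1) ω}

lemma disjoint_legEvent {Ω : Type*} {θ : ℕ → Ω → ℝ} (hpos : ∀ ω i, 0 < θ i ω) (t : ℝ) :
    Pairwise (Function.onFun Disjoint (legEvent θ t)) := by
  intro k l hkl
  refine Set.disjoint_left.2 fun ω hk hl => hkl ?_
  rw [← alternations_eq (hpos ω) hk.1 hk.2, alternations_eq (hpos ω) hl.1 hl.2]

/-- The density at `x` of the law of the position at time `t` on the event that exactly `k + 1`
velocity alternations happen up to time `t`. -/
noncomputable def legDensity (m : ℕ) (v lam t : ℝ) (k : ℕ) (x : ℝ) : ℝ :=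
  (2 * v)⁻¹ * (erlangDensity ((k / 2 + 1) * m - 1) lam ((t - (-1) ^ (k + 1) * (x / v)) / 2) *
    coverWeight m lam ((k + 1) / 2) (t - (t - (-1) ^ (k + 1) * (x / v)) / 2))

lemma erlangDensity_nonneg {lam : ℝ} (hlam : 0 < lam) (n : ℕ) (x : ℝ) :
    0 ≤ erlangDensity n lam x := by
  unfold erlangDensity
  split_ifs with h
  · exact mul_nonneg hlam.le (poissonWeight_nonneg (mul_nonneg hlam.le h) _)
  · rfl

lemma coverWeight_nonneg {lam : ℝ} (hlam : 0 < lam) (m q : ℕ) (u : ℝ) :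
    0 ≤ coverWeight m lam q u := by
  unfold coverWeight
  split_ifs with h
  · exact Finset.sum_nonneg fun i _ => poissonWeight_nonneg (mul_nonneg hlam.le h) _
  · rfl

lemma legDensity_nonneg (m : ℕ) {v lam : ℝ} (hv : 0 < v) (hlam : 0 < lam) (t : ℝ) (k : ℕ)
    (x : ℝ) : 0 ≤ legDensity m v lam t k x :=
  mul_nonneg (by positivity) (mul_nonneg (erlangDensity_nonneg hlam _ _)
    (coverWeight_nonneg hlam _ _ _))

@[fun_prop]
lemma measurable_legDensity (m : ℕ) (v lam t : ℝ) (k : ℕ) :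
    Measurable (legDensity m v lam t k) := by
  unfold legDensity
  fun_prop

lemma lintegral_comp_affine (F : ℝ → ENNReal) (hF : Measurable F) {a : ℝ} (ha : a ≠ 0) (b : ℝ) :
    ∫⁻ x, F (a * x + b) = ENNReal.ofReal |a⁻¹| * ∫⁻ x, F x := by
  calc ∫⁻ x, F (a * x + b) = ∫⁻ y, F (y + b) ∂(Measure.map (a * ·) volume) :=
        (lintegral_map (f := fun y => F (y + b)) (by fun_prop) (by fun_prop)).symm
    _ = ENNReal.ofReal |a⁻¹| * ∫⁻ y, F (y + b) := by
        rw [Real.map_volume_mul_left ha, lintegral_smul_measure, smul_eq_mul]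
    _ = _ := by rw [lintegral_add_right_eq_self]

section Law

variable {Ω : Type*} [MeasurableSpace Ω] {P : Measure Ω} {m : ℕ} {v lam t : ℝ} {θ : ℕ → Ω → ℝ}

lemma measurableSet_legEvent (hmeas : ∀ i, Measurable (θ i)) (t : ℝ) (k : ℕ) :
    MeasurableSet (legEvent θ t k) := by
  have h : ∀ k, Measurable (epoch θ k) := fun k => by unfold epoch; fun_prop
  exact (measurableSet_le (h k) measurable_const).inter (measurableSet_lt measurable_const (h _))

/-- If no epoch exceeds `t`, then for every `n` the `n`-th is at most `t`. That has the probability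
of a Poisson tail from `n * m`, which tends to zero. -/
lemma ae_exists_lt_epoch [IsProbabilityMeasure P] (hm : 1 ≤ m) (hlam : 0 < lam)
    (hmeas : ∀ i, Measurable (θ i)) (hindep : iIndepFun θ P)
    (hlaw : ∀ i, HasLaw (θ i) (erlang m lam) P) (ht : 0 ≤ t) :
    ∀ᵐ ω ∂P, ∃ n, t < epoch θ n ω := by
  have hle : ∀ n, P {ω | ¬ ∃ n, t < epoch θ n ω} ≤
      ENNReal.ofReal (1 - ∑ i ∈ Finset.range (n * m), poissonWeight i (lam * t)) := fun n => by
    have h := measure_sum_le hm hlam hmeas hindep hlaw (Finset.range n) ht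
    rw [Finset.card_range] at h
    rw [← h]
    refine measure_mono fun ω hω => ?_
    simp only [not_exists, not_lt, Set.mem_ofPred_eq] at hω
    exact hω n
  have hlim : Filter.Tendsto (fun n => ENNReal.ofReal
      (1 - ∑ i ∈ Finset.range (n * m), poissonWeight i (lam * t))) Filter.atTop (nhds 0) := by
    have h1 := (hasSum_poissonWeight (lam * t)).tendsto_sum_nat.comp
      (Filter.tendsto_id.atTop_mul_const' (Nat.lt_of_lt_of_le Nat.zero_lt_one hm))
    have h2 := ENNReal.tendsto_ofReal (h1.const_sub 1)
    simpa using h2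
  exact le_antisymm (ge_of_tendsto' hlim hle) zero_le

lemma measure_legEvent_inter_position [IsProbabilityMeasure P] (hm : 1 ≤ m) (hv : 0 < v)
    (hlam : 0 < lam) (hmeas : ∀ i, Measurable (θ i)) (hpos : ∀ ω i, 0 < θ i ω)
    (hindep : iIndepFun θ P) (hlaw : ∀ i, HasLaw (θ i) (erlang m lam) P) (k : ℕ) {B : Set ℝ}
    (hB : MeasurableSet B) : P (legEvent θ t (k + 1) ∩ position v θ t ⁻¹' B) =
      ∫⁻ x in B, ENNReal.ofReal (legDensity m v lam t k x) := by
  -- The sign `s` is the direction of the current leg. On the event the position is `s * v * (t - 2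
  -- * d)`, with `d` the time spent moving the other way.
  set s : ℝ := (-1) ^ (k + 1) with hs
  have hss : s * s = 1 := by rw [hs, ← mul_pow]; simp
  have hs0 : s ≠ 0 := fun h => by simp [h] at hss
  set B' : Set ℝ := (fun d => s * v * (t - 2 * d)) ⁻¹' B
  have hB' : MeasurableSet B' := hB.preimage (by fun_prop)
  have hset : legEvent θ t (k + 1) ∩ position v θ t ⁻¹' B =
      {ω | ∑ i ∈ unlikeLegs (k + 1), θ i ω ∈ B' ∧
        ∑ i ∈ likeLegs (k + 1), θ i ω ≤ t - ∑ i ∈ unlikeLegs (k + 1), θ i ω ∧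
        t - ∑ i ∈ unlikeLegs (k + 1), θ i ω <
          ∑ i ∈ likeLegs (k + 1), θ i ω + θ (k + 1) ω} := by
    ext ω
    have h1 : epoch θ (k + 1) ω ≤ t ↔
        ∑ i ∈ likeLegs (k + 1), θ i ω ≤ t - ∑ i ∈ unlikeLegs (k + 1), θ i ω := by
      rw [epoch, ← sum_legs, le_sub_iff_add_le]
    have h2 : t < epoch θ (k + 1 + 1) ω ↔ t - ∑ i ∈ unlikeLegs (k + 1), θ i ω <
          ∑ i ∈ likeLegs (k + 1), θ i ω + θ (k + 1) ω := by
      rw [epoch, Finset.sum_range_succ, ← sum_legs, sub_lt_iff_lt_add, add_right_comm]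
    simp only [legEvent, Set.mem_inter_iff, Set.mem_ofPred_eq, Set.mem_preimage, ← h1, ← h2, B']
    rw [and_comm]
    refine and_congr_left fun h => ?_
    rw [position_eq v (hpos ω) h.1 h.2]
  have hne : (unlikeLegs (k + 1)).Nonempty := by
    rw [unlikeLegs_succ]
    exact Finset.insert_nonempty _ _
  rw [hset, measure_sum_mem_cover hm hlam hmeas hindep hlaw hne (disjoint_legs _)
    (notMem_unlikeLegs _) (notMem_likeLegs _) t hB', (card_legs _).1, (card_legs _).2,
    show (k + 1 + 1) / 2 = k / 2 + 1 by omega]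
  set F : ℝ → ENNReal := B'.indicator fun d =>
    ENNReal.ofReal (erlangDensity ((k / 2 + 1) * m - 1) lam d) *
      ENNReal.ofReal (coverWeight m lam ((k + 1) / 2) (t - d)) with hF
  have hFm : Measurable F := Measurable.indicator (by fun_prop) hB'
  have ha : -(s / (2 * v)) ≠ 0 := by simp [hs0, hv.ne']
  -- The factor `(2 * v)⁻¹` in `legDensity` is the Jacobian of the substitution `d = (t - s * (x /
  -- v)) / 2`.
  have habs : ENNReal.ofReal (2 * v)⁻¹ * ENNReal.ofReal |(-(s / (2 * v)))⁻¹| = 1 := by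
    have : |s| = 1 := by simp [hs]
    rw [← ENNReal.ofReal_mul (by positivity), abs_inv, abs_neg, abs_div, this,
      abs_of_pos (by positivity : 0 < 2 * v)]
    rw [one_div, inv_inv, inv_mul_cancel₀ (by positivity), ENNReal.ofReal_one]
  have hchange := lintegral_comp_affine F hFm ha (t / 2)
  calc ∫⁻ d, F d = ENNReal.ofReal (2 * v)⁻¹ * ∫⁻ x, F (-(s / (2 * v)) * x + t / 2) := by
        rw [hchange, ← mul_assoc, habs, one_mul]
    _ = ∫⁻ x, ENNReal.ofReal (2 * v)⁻¹ * F (-(s / (2 * v)) * x + t / 2) :=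
        (lintegral_const_mul _ (by fun_prop)).symm
    _ = ∫⁻ x, B.indicator (fun x => ENNReal.ofReal (legDensity m v lam t k x)) x := by
        refine lintegral_congr fun x => ?_
        have hx : -(s / (2 * v)) * x + t / 2 = (t - s * (x / v)) / 2 := by
          field_simp
          ring
        have hmem : (t - s * (x / v)) / 2 ∈ B' ↔ x ∈ B := by
          have : s * v * (t - 2 * ((t - s * (x / v)) / 2)) = x := by
            field_simp
            linear_combination x * hss
          simp only [B', Set.mem_preimage, this]
        rw [hx, hF]
        by_cases h : x ∈ B
        · rw [Set.indicator_of_mem h, Set.indicator_of_mem (hmem.2 h), legDensity,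
            ENNReal.ofReal_mul (by positivity), ENNReal.ofReal_mul (erlangDensity_nonneg hlam _ _)]
        · rw [Set.indicator_of_notMem h, Set.indicator_of_notMem (mt hmem.1 h), mul_zero]
    _ = _ := lintegral_indicator hB _

lemma aemeasurable_position [IsProbabilityMeasure P] (hm : 1 ≤ m) (hlam : 0 < lam)
    (hmeas : ∀ i, Measurable (θ i)) (hpos : ∀ ω i, 0 < θ i ω) (hindep : iIndepFun θ P)
    (hlaw : ∀ i, HasLaw (θ i) (erlang m lam) P) (ht : 0 ≤ t) :
    AEMeasurable (position v θ t) P := by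
  have hcover : ∀ᵐ ω ∂P, ω ∈ ⋃ k, legEvent θ t k := by
    filter_upwards [ae_exists_lt_epoch hm hlam hmeas hindep hlaw ht] with ω hω
    exact Set.mem_iUnion.2 (exists_epoch_le_lt ht hω)
  rw [← Measure.restrict_eq_self_of_ae_mem hcover]
  refine aemeasurable_iUnion_iff.2 fun k => ?_
  refine AEMeasurable.congr (f := fun ω => (-1) ^ k * v * (t - 2 * ∑ i ∈ unlikeLegs k, θ i ω))
    (by fun_prop) ?_
  filter_upwards [ae_restrict_mem (measurableSet_legEvent hmeas t k)] with ω hω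
  exact (position_eq v (hpos ω) hω.1 hω.2).symm

lemma map_position [IsProbabilityMeasure P] (hm : 1 ≤ m) (hv : 0 < v) (hlam : 0 < lam)
    (hmeas : ∀ i, Measurable (θ i)) (hpos : ∀ ω i, 0 < θ i ω) (hindep : iIndepFun θ P)
    (hlaw : ∀ i, HasLaw (θ i) (erlang m lam) P) (ht : 0 ≤ t) :
    P.map (position v θ t) = P (legEvent θ t 0) • Measure.dirac (v * t) +
      volume.withDensity fun x => ∑' k, ENNReal.ofReal (legDensity m v lam t k x) := by
  have hcover : ∀ᵐ ω ∂P, ω ∈ ⋃ k, legEvent θ t k := by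
    filter_upwards [ae_exists_lt_epoch hm hlam hmeas hindep hlaw ht] with ω hω
    exact Set.mem_iUnion.2 (exists_epoch_le_lt ht hω)
  have hX := aemeasurable_position (v := v) hm hlam hmeas hpos hindep hlaw ht
  refine Measure.ext fun B hB => ?_
  -- The position is only known to be a.e. measurable, so its preimage is only null measurable.
  -- Hence `Measure.sum_apply₀`.
  have hsum : P (position v θ t ⁻¹' B) = ∑' k, P (legEvent θ t k ∩ position v θ t ⁻¹' B) := by
    have hnull := hX.nullMeasurableSet_preimage hB
    calc P (position v θ t ⁻¹' B) = P.restrict (⋃ k, legEvent θ t k) (position v θ t ⁻¹' B) := by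
          rw [Measure.restrict_eq_self_of_ae_mem hcover]
      _ = ∑' k, P.restrict (legEvent θ t k) (position v θ t ⁻¹' B) := by
          rw [Measure.restrict_iUnion (disjoint_legEvent hpos t) (measurableSet_legEvent hmeas t),
            Measure.sum_apply₀]
          rw [← Measure.restrict_iUnion (disjoint_legEvent hpos t) (measurableSet_legEvent hmeas t)]
          exact hnull.mono_ac Measure.restrict_le_self.absolutelyContinuous
      _ = _ := by
          refine tsum_congr fun k => ?_
          rw [Measure.restrict_apply' (measurableSet_legEvent hmeas t k), Set.inter_comm]
  have h0 : P (legEvent θ t 0 ∩ position v θ t ⁻¹' B) =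
      (P (legEvent θ t 0) • Measure.dirac (v * t)) B := by
    have hp : ∀ ω ∈ legEvent θ t 0, position v θ t ω = v * t := fun ω hω => by
      rw [position_eq v (hpos ω) hω.1 hω.2]
      simp [unlikeLegs]
    rw [Measure.smul_apply, Measure.dirac_apply' _ hB, smul_eq_mul]
    by_cases h : v * t ∈ B
    · rw [Set.indicator_of_mem h, Pi.one_apply, mul_one, Set.inter_eq_left.2]
      intro ω hω
      rwa [Set.mem_preimage, hp ω hω]
    · rw [Set.indicator_of_notMem h, mul_zero, ← measure_empty (μ := P)]
      congr 1
      refine Set.eq_empty_of_forall_notMem fun ω hω => h ?_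
      rw [← hp ω hω.1]
      exact hω.2
  rw [Measure.map_apply_of_aemeasurable hX hB, hsum, tsum_eq_zero_add' ENNReal.summable, h0,
    Measure.add_apply, withDensity_apply _ hB, lintegral_tsum (by fun_prop)]
  congr 1
  exact tsum_congr fun k =>
    measure_legEvent_inter_position hm hv hlam hmeas hpos hindep hlaw k hB

lemma rnDeriv_map_position [IsProbabilityMeasure P] (hm : 1 ≤ m) (hv : 0 < v) (hlam : 0 < lam)
    (hmeas : ∀ i, Measurable (θ i)) (hpos : ∀ ω i, 0 < θ i ω) (hindep : iIndepFun θ P)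
    (hlaw : ∀ i, HasLaw (θ i) (erlang m lam) P) (ht : 0 ≤ t) :
    (P.map (position v θ t)).rnDeriv volume =ᵐ[volume]
      fun x => ∑' k, ENNReal.ofReal (legDensity m v lam t k x) :=
  (Measure.eq_rnDeriv (Measurable.tsum fun k => by fun_prop)
    ((mutuallySingular_dirac (v * t) volume).smul _)
    (map_position hm hv hlam hmeas hpos hindep hlaw ht)).symm

end Law


/-! ### The coefficients of the density and their summation. -/

/-- Coefficients of the contribution of odd numbers of alternations to the density. -/
def oddCoeff (m i j : ℕ) : ℝ := if m ∣ i + 1 ∧ i / m = j / m then 1 else 0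

/-- Coefficients of the contribution of positive even numbers of alternations to the density. -/
def evenCoeff (m i j : ℕ) : ℝ := if m ∣ j + 1 ∧ i / m = j / m + 1 then 1 else 0

/-- Coefficients of the density in the characteristic coordinates. -/
def waveCoeff (m i j : ℕ) : ℝ := oddCoeff m i j + evenCoeff m i j

lemma abs_oddCoeff_le (m i j : ℕ) : |oddCoeff m i j| ≤ 1 := by
  unfold oddCoeff; split_ifs <;> simp

lemma abs_evenCoeff_le (m i j : ℕ) : |evenCoeff m i j| ≤ 1 := by
  unfold evenCoeff; split_ifs <;> simp

lemma abs_waveCoeff_le (m i j : ℕ) : |waveCoeff m i j| ≤ 2 :=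
  (abs_add_le _ _).trans (by linarith [abs_oddCoeff_le m i j, abs_evenCoeff_le m i j])

/-- The coefficients see only whether an index ends a block of length `m` and how the two block
numbers compare. Moving both indices by one block changes neither. -/
lemma waveCoeff_add_add {m : ℕ} (hm : 1 ≤ m) (i j : ℕ) :
    waveCoeff m (i + m) (j + m) = waveCoeff m i j := by
  have hd : ∀ i, m ∣ i + m + 1 ↔ m ∣ i + 1 := fun i => by
    rw [add_right_comm, Nat.dvd_add_self_right]
  simp only [waveCoeff, oddCoeff, evenCoeff, Nat.add_div_right _ hm, hd,
    Nat.add_right_cancel_iff]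

lemma exists_block_index {m : ℕ} (hm : 1 ≤ m) (j : ℕ) : ∃ i : Fin m, j = j / m * m + i :=
  ⟨⟨j % m, Nat.mod_lt _ hm⟩, (Nat.div_add_mod' j m).symm⟩

lemma block_div {m : ℕ} (hm : 1 ≤ m) (q : ℕ) (i : Fin m) : (q * m + i) / m = q := by
  rw [add_comm, Nat.add_mul_div_right _ _ hm, Nat.div_eq_of_lt i.2, zero_add]

lemma last_div {m : ℕ} (hm : 1 ≤ m) (q : ℕ) : ((q + 1) * m - 1) / m = q := by
  have h : (q + 1) * m - 1 = q * m + (⟨m - 1, by omega⟩ : Fin m) := by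
    rw [add_mul, one_mul, Nat.add_sub_assoc hm]
  rw [h, block_div hm]

lemma last_dvd {m : ℕ} (hm : 1 ≤ m) (q : ℕ) : m ∣ (q + 1) * m - 1 + 1 := by
  rw [Nat.sub_add_cancel (Nat.mul_pos q.succ_pos hm)]
  exact Dvd.intro_left _ rfl

lemma eq_last_of_dvd {m : ℕ} (hm : 1 ≤ m) {i : ℕ} (h : m ∣ i + 1) : i = (i / m + 1) * m - 1 := by
  obtain ⟨k, hk⟩ := h
  cases k with
  | zero => omega
  | succ k =>
    have hi : i = (k + 1) * m - 1 := by
      rw [mul_comm] at hk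
      omega
    have hd := last_div hm k
    rw [← hi] at hd
    rw [hd]
    exact hi

/-- The support of `oddCoeff` is parametrized injectively by a block number `q` and a position in
the block: the first index ends block `q` and the second runs through it. Summing over the position
first gives the stated series. -/
lemma hasSum_oddCoeff {m : ℕ} (hm : 1 ≤ m) (p : ℝ × ℝ) :
    HasSum (fun q : ℕ => p.1 ^ ((q + 1) * m - 1) / ((q + 1) * m - 1).factorial *
      ∑ i ∈ Finset.range m, p.2 ^ (q * m + i) / (q * m + i).factorial)
      (biExp (oddCoeff m) p) := by
  let ι : ℕ × Fin m → ℕ × ℕ := fun k => ((k.1 + 1) * m - 1, k.1 * m + k.2)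
  have hι : Function.Injective ι := by
    rintro ⟨a, b⟩ ⟨a', b'⟩ h
    simp only [ι, Prod.mk.injEq] at h
    have ha : a = a' := by rw [← last_div hm a, h.1, last_div hm]
    subst ha
    exact Prod.ext rfl (Fin.ext (by simpa using h.2))
  have h1 := (summable_biExp (abs_oddCoeff_le m) p).hasSum
  rw [← hι.hasSum_iff] at h1
  · have h2 := h1.prod_fiberwise fun q => hasSum_fintype _
    refine h2.congr_fun ?_
    intro q
    rw [Finset.mul_sum, ← Fin.sum_univ_eq_sum_range (fun i =>
      p.1 ^ ((q + 1) * m - 1) / ((q + 1) * m - 1).factorial *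
        (p.2 ^ (q * m + i) / (q * m + i).factorial))]
    refine Finset.sum_congr rfl fun i _ => ?_
    simp only [ι, Function.comp_apply, oddCoeff, last_dvd hm, last_div hm, block_div hm, and_self,
      if_true, one_mul]
  · rintro ⟨a, b⟩ h
    have : oddCoeff m a b = 0 := if_neg fun hab => h (by
      obtain ⟨i, hi⟩ := exists_block_index hm b
      exact ⟨(a / m, i), Prod.ext (eq_last_of_dvd hm hab.1).symm
        (by simp only [ι]; rw [hab.2]; exact hi.symm)⟩)
    simp [this]

/-- The coordinates exchange roles and the running index lies one block later. The initial forward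
leg gives an even number of alternations one more forward leg before the current one is counted out.
-/
lemma hasSum_evenCoeff {m : ℕ} (hm : 1 ≤ m) (p : ℝ × ℝ) :
    HasSum (fun q : ℕ => p.2 ^ ((q + 1) * m - 1) / ((q + 1) * m - 1).factorial *
      ∑ i ∈ Finset.range m, p.1 ^ ((q + 1) * m + i) / ((q + 1) * m + i).factorial)
      (biExp (evenCoeff m) p) := by
  let ι : ℕ × Fin m → ℕ × ℕ := fun k => ((k.1 + 1) * m + k.2, (k.1 + 1) * m - 1)
  have hι : Function.Injective ι := by
    rintro ⟨a, b⟩ ⟨a', b'⟩ h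
    simp only [ι, Prod.mk.injEq] at h
    have ha : a = a' := by rw [← last_div hm a, h.2, last_div hm]
    subst ha
    exact Prod.ext rfl (Fin.ext (by simpa using h.1))
  have h1 := (summable_biExp (abs_evenCoeff_le m) p).hasSum
  rw [← hι.hasSum_iff] at h1
  · have h2 := h1.prod_fiberwise fun q => hasSum_fintype _
    refine h2.congr_fun ?_
    intro q
    rw [Finset.mul_sum, ← Fin.sum_univ_eq_sum_range (fun i =>
      p.2 ^ ((q + 1) * m - 1) / ((q + 1) * m - 1).factorial *
        (p.1 ^ ((q + 1) * m + i) / ((q + 1) * m + i).factorial))]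
    refine Finset.sum_congr rfl fun i _ => ?_
    simp only [ι, Function.comp_apply, evenCoeff, last_dvd hm, last_div hm, block_div hm, and_self,
      if_true, one_mul]
    exact mul_comm _ _
  · rintro ⟨a, b⟩ h
    have : evenCoeff m a b = 0 := if_neg fun hab => h (by
      obtain ⟨i, hi⟩ := exists_block_index hm a
      exact ⟨(b / m, i), Prod.ext (by simp only [ι]; rw [← hab.2]; exact hi.symm)
        (eq_last_of_dvd hm hab.1).symm⟩)
    simp [this]

lemma biExp_waveCoeff (m : ℕ) (p : ℝ × ℝ) :
    biExp (waveCoeff m) p = biExp (oddCoeff m) p + biExp (evenCoeff m) p := by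
  simp only [biExp, waveCoeff, add_mul]
  exact (summable_biExp (abs_oddCoeff_le m) p).tsum_add (summable_biExp (abs_evenCoeff_le m) p)

/-- The density of the absolutely continuous part of the law of the position. -/
noncomputable def waveDensity (m : ℕ) (v lam t x : ℝ) : ℝ :=
  if |x / v| < t then lam / (2 * v) * dampedWave v lam (waveCoeff m) t x else 0

/-- Outside the cone one characteristic coordinate is negative, so every term vanishes. Inside, both
cutoffs are inactive and the two exponentials combine to `exp (-(lam * t))`. -/
lemma hasSum_legDensity {m : ℕ} (hm : 1 ≤ m) {v lam t x : ℝ} (hx : t ≠ |x / v|) :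
    HasSum (fun k => legDensity m v lam t k x) (waveDensity m v lam t x) := by
  rcases lt_or_gt_of_ne hx with h | h
  · rw [waveDensity, if_neg h.not_gt]
    convert hasSum_zero using 2 with k
    have hneg : (t - (-1) ^ (k + 1) * (x / v)) / 2 < 0 ∨
        t - (t - (-1) ^ (k + 1) * (x / v)) / 2 < 0 := by
      rcases neg_one_pow_eq_or ℝ (k + 1) with hk | hk <;> rw [hk] <;>
        rcases lt_abs.1 h with h | h
      · left; linarith
      · right; linarith
      · right; linarith
      · left; linarith
    rcases hneg with h | h
    · simp [legDensity, erlangDensity, h.not_ge]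
    · simp [legDensity, coverWeight, h.not_ge]
  · obtain ⟨h1, h2⟩ := abs_lt.1 h
    rw [waveDensity, if_pos h, dampedWave, biExp_waveCoeff]
    set a := (t + x / v) / 2 with ha
    set b := (t - x / v) / 2 with hb
    have hab : Real.exp (-(lam * t)) = Real.exp (-(lam * a)) * Real.exp (-(lam * b)) := by
      rw [← Real.exp_add]; congr 1; rw [ha, hb]; ring
    have ha0 : 0 ≤ a := by linarith
    have hb0 : 0 ≤ b := by linarith
    have hta : t - a = b := by rw [ha, hb]; ring
    have htb : t - b = a := by rw [ha, hb]; ring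
    rw [mul_add, mul_add]
    -- The index `k` stands for `k + 1` alternations, so even `k` goes with `oddCoeff` and odd `k`
    -- with `evenCoeff`.
    refine HasSum.even_add_odd ?_ ?_
    · refine (((hasSum_oddCoeff hm (lam * a, lam * b)).mul_left
        (Real.exp (-(lam * t)))).mul_left (lam / (2 * v))).congr_fun fun q => ?_
      have hd : (t - (-1) ^ (2 * q + 1) * (x / v)) / 2 = a := by
        rw [(odd_two_mul_add_one q).neg_one_pow, ha]; ring
      rw [legDensity, hd, hta, erlangDensity, coverWeight, if_pos ha0, if_pos hb0,
        show 2 * q / 2 = q by omega, show (2 * q + 1) / 2 = q by omega, hab]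
      simp only [poissonWeight, ← Finset.mul_sum]
      ring
    · refine (((hasSum_evenCoeff hm (lam * a, lam * b)).mul_left
        (Real.exp (-(lam * t)))).mul_left (lam / (2 * v))).congr_fun fun q => ?_
      have hd : (t - (-1) ^ (2 * q + 1 + 1) * (x / v)) / 2 = b := by
        rw [(show Even (2 * q + 1 + 1) from ⟨q + 1, by ring⟩).neg_one_pow, hb]; ring
      rw [legDensity, hd, htb, erlangDensity, coverWeight, if_pos ha0, if_pos hb0,
        show (2 * q + 1) / 2 = q by omega, show (2 * q + 1 + 1) / 2 = q + 1 by omega, hab]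
      simp only [poissonWeight, ← Finset.mul_sum]
      ring

/-! ### Regularity and the equation off the singular lines. -/

lemma isOpen_offLines (v : ℝ) : IsOpen (offLines v) :=
  (isOpen_lt continuous_const continuous_fst).inter
    (isOpen_ne_fun continuous_fst (by fun_prop))

lemma isOpen_insideCone (v : ℝ) : IsOpen {p : ℝ × ℝ | |p.2 / v| < p.1} :=
  isOpen_lt (by fun_prop) continuous_fst

lemma isOpen_outsideCone (v : ℝ) : IsOpen {p : ℝ × ℝ | p.1 < |p.2 / v|} :=
  isOpen_lt continuous_fst (by fun_prop)

/-- Off the lines a point has a neighbourhood inside the cone or outside it. There the density is a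
multiple of a damped wave, or zero. -/
lemma contDiffOn_waveDensity (m : ℕ) (v lam : ℝ) (n : ℕ) :
    ContDiffOn ℝ n (Function.uncurry (waveDensity m v lam)) (offLines v) := by
  rintro ⟨t, x⟩ ⟨-, hx⟩
  refine ContDiffAt.contDiffWithinAt ?_
  rcases lt_or_gt_of_ne hx with h | h
  · refine (contDiffAt_const (c := (0 : ℝ))).congr_of_eventuallyEq ?_
    filter_upwards [(isOpen_outsideCone v).mem_nhds h] with p hp
    exact if_neg (not_lt.2 (le_of_lt hp))
  · refine (contDiff_const.mul (contDiff_dampedWave v lam (abs_waveCoeff_le m) n)).contDiffAt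
      |>.congr_of_eventuallyEq (f := fun p => lam / (2 * v) *
        Function.uncurry (dampedWave v lam (waveCoeff m)) p) ?_
    filter_upwards [(isOpen_insideCone v).mem_nhds h] with p hp
    exact if_pos hp

lemma transportOp_iterate_zero (c lam : ℝ) (n : ℕ) :
    (transportOp c lam)^[n] (fun _ _ => 0) = fun _ _ => 0 := by
  simpa using transportOp_iterate_const_mul c lam 0 (fun _ _ => 0) n

lemma transportOp_iterate_waveDensity {m : ℕ} (hm : 1 ≤ m) {v : ℝ} (hv : v ≠ 0) (lam : ℝ)
    {t x : ℝ} (hx : t ≠ |x / v|) :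
    (transportOp (-v) lam)^[m] ((transportOp v lam)^[m] (waveDensity m v lam)) t x =
      lam ^ (2 * m) * waveDensity m v lam t x := by
  rcases lt_or_gt_of_ne hx with h | h
  · have hU := isOpen_outsideCone v
    rw [transportOp_iterate_eqOn hU m (transportOp_iterate_eqOn hU m (u := waveDensity m v lam)
      (w := fun _ _ => 0) fun s y hs => if_neg (not_lt.2 (le_of_lt (α := ℝ) hs))) t x h, transportOp_iterate_zero,
      transportOp_iterate_zero, waveDensity, if_neg h.not_gt, mul_zero]
  · have hU := isOpen_insideCone v
    rw [transportOp_iterate_eqOn hU m (transportOp_iterate_eqOn hU m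
      (u := waveDensity m v lam) (w := fun t x => lam / (2 * v) * dampedWave v lam (waveCoeff m) t x)
      fun s y hs => if_pos hs) t x h, transportOp_iterate_const_mul, transportOp_iterate_const_mul,
      transportOp_iterate_iterate_dampedWave hv lam m (abs_waveCoeff_le m) (waveCoeff_add_add hm),
      waveDensity, if_pos h]
    ring

/-! ### Identification and uniqueness of the continuous version. -/

lemma ae_ne_abs_div {v : ℝ} (hv : v ≠ 0) (t : ℝ) : ∀ᵐ x : ℝ, t ≠ |x / v| := by
  have hfin : ({t * v, -(t * v)} : Set ℝ).Finite := Set.toFinite _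
  filter_upwards [hfin.countable.ae_notMem volume] with x hx h
  refine hx ?_
  rcases abs_choice (x / v) with h' | h' <;> rw [h'] at h
  · left; rw [h]; field_simp
  · right; rw [Set.mem_singleton_iff, h]; field_simp

lemma position_congr {Ω : Type*} {θ θ' : ℕ → Ω → ℝ} {ω : Ω} (h : ∀ i, θ i ω = θ' i ω) (v t : ℝ) :
    position v θ t ω = position v θ' t ω := by
  simp only [position, alternations, epoch, h]

section Law

variable {Ω : Type*} [MeasurableSpace Ω] {P : Measure Ω} {m : ℕ} {v lam : ℝ} {θ : ℕ → Ω → ℝ}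

lemma isContinuousPart_waveDensity_of_measurable [IsProbabilityMeasure P] (hm : 1 ≤ m)
    (hv : 0 < v) (hlam : 0 < lam) (hmeas : ∀ i, Measurable (θ i)) (hpos : ∀ ω i, 0 < θ i ω)
    (hindep : iIndepFun θ P) (hlaw : ∀ i, HasLaw (θ i) (erlang m lam) P) :
    IsContinuousPart P (position v θ) v (waveDensity m v lam) where
  density t ht := by
    filter_upwards [rnDeriv_map_position (v := v) hm hv hlam hmeas hpos hindep hlaw ht.le,
      ae_ne_abs_div hv.ne' t] with x hx hne
    have hs := hasSum_legDensity hm (lam := lam) hne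
    have hnonneg := fun k => legDensity_nonneg m hv hlam t k x
    rw [hx, ← ENNReal.ofReal_tsum_of_nonneg hnonneg hs.summable, hs.tsum_eq,
      ENNReal.toReal_ofReal (hs.nonneg hnonneg)]
  continuousOn := (contDiffOn_waveDensity m v lam 0).continuousOn

/-- The laws give only a.e. measurability and a.s. positivity, whereas the path lemmas need
positivity at every sample point. The default `1` is an arbitrary positive value, used on a null
set. -/
lemma exists_measurable_pos_modification (hm : 1 ≤ m)
    (hlaw : ∀ i, HasLaw (θ i) (erlang m lam) P) :
    ∃ θ' : ℕ → Ω → ℝ, (∀ i, Measurable (θ' i)) ∧ (∀ ω i, 0 < θ' i ω) ∧ ∀ i, θ i =ᵐ[P] θ' i := by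
  let μ : ℕ → Ω → ℝ := fun i => (hlaw i).aemeasurable.mk (θ i)
  have hμ : ∀ i, Measurable (μ i) := fun i => (hlaw i).aemeasurable.measurable_mk
  refine ⟨fun i ω => if 0 < μ i ω then μ i ω else 1, fun i =>
    Measurable.ite (measurableSet_lt measurable_const (hμ i)) (hμ i) measurable_const,
    fun ω i => ?_, fun i => ?_⟩
  · dsimp only
    split_ifs with h
    · exact h
    · exact one_pos
  · filter_upwards [ae_pos hm hlaw, (hlaw i).aemeasurable.ae_eq_mk] with ω hω hi
    have hi : θ i ω = μ i ω := hi
    rw [if_pos (hi ▸ hω i), hi]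

lemma isContinuousPart_congr {X Y : ℝ → Ω → ℝ} (h : ∀ t, X t =ᵐ[P] Y t) {fc : ℝ → ℝ → ℝ}
    (hX : IsContinuousPart P X v fc) : IsContinuousPart P Y v fc :=
  ⟨fun t ht => by rw [← Measure.map_congr (h t)]; exact hX.density t ht, hX.continuousOn⟩

/-- For fixed `t` both slices are continuous on an open set and agree almost everywhere. Nonempty
open sets have positive Lebesgue measure, so they agree at every point of it. -/
lemma IsContinuousPart.eq {X : ℝ → Ω → ℝ} {fc gc : ℝ → ℝ → ℝ} (hf : IsContinuousPart P X v fc)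
    (hg : IsContinuousPart P X v gc) {t x : ℝ} (ht : 0 < t) (hx : t ≠ |x / v|) :
    fc t x = gc t x := by
  have hU : IsOpen {y : ℝ | t ≠ |y / v|} := isOpen_ne_fun continuous_const (by fun_prop)
  have hslice : ∀ {f : ℝ → ℝ → ℝ}, ContinuousOn (Function.uncurry f) (offLines v) →
      ContinuousOn (f t) {y : ℝ | t ≠ |y / v|} := fun hc =>
    hc.comp (f := fun y => (t, y)) (by fun_prop) fun y hy => ⟨ht, hy⟩
  exact Measure.eqOn_open_of_ae_eq (μ := volume)
    (ae_restrict_of_ae ((hf.density t ht).symm.trans (hg.density t ht))) hU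
    (hslice hf.continuousOn) (hslice hg.continuousOn) hx

end Law

end ErlangMotion

theorem corollary1 {Ω : Type*} [MeasurableSpace Ω] (P : Measure Ω) [IsProbabilityMeasure P]
    (m : ℕ) (hm : 1 ≤ m) (v lam : ℝ) (hv : 0 < v) (hlam : 0 < lam)
    (θ : ℕ → Ω → ℝ) (hindep : iIndepFun θ P)
    (hlaw : ∀ i, HasLaw (θ i) (ErlangMotion.erlang m lam) P) :
    (∀ t : ℝ, 0 < t → AEMeasurable (ErlangMotion.position v θ t) P) ∧
    (∃ fc : ℝ → ℝ → ℝ,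
      ErlangMotion.IsContinuousPart P (ErlangMotion.position v θ) v fc) ∧
    ∀ fc : ℝ → ℝ → ℝ, ErlangMotion.IsContinuousPart P (ErlangMotion.position v θ) v fc →
      ContDiffOn ℝ ((2 * m : ℕ) : WithTop ℕ∞) (Function.uncurry fc) (ErlangMotion.offLines v) ∧
      ∀ t x : ℝ, 0 < t → t ≠ |x / v| →
        (ErlangMotion.transportOp (-v) lam)^[m] ((ErlangMotion.transportOp v lam)^[m] fc) t x
          - lam ^ (2 * m) * fc t x = 0 := by
  obtain ⟨θ', hmeas, hpos, heq⟩ := ErlangMotion.exists_measurable_pos_modification hm hlaw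
  have hindep' : iIndepFun θ' P := hindep.congr heq
  have hlaw' : ∀ i, HasLaw (θ' i) (ErlangMotion.erlang m lam) P := fun i =>
    (hlaw i).congr (heq i).symm
  have hX : ∀ t, ErlangMotion.position v θ' t =ᵐ[P] ErlangMotion.position v θ t := fun t => by
    filter_upwards [ae_all_iff.2 heq] with ω hω
    exact (ErlangMotion.position_congr hω v t).symm
  have hpart := ErlangMotion.isContinuousPart_congr hX
    (ErlangMotion.isContinuousPart_waveDensity_of_measurable hm hv hlam hmeas hpos hindep' hlaw')
  refine ⟨fun t ht => (ErlangMotion.aemeasurable_position hm hlam hmeas hpos hindep' hlaw'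
    ht.le).congr (hX t), ⟨_, hpart⟩, fun fc hfc => ?_⟩
  -- Uniqueness reduces an arbitrary version to the explicit one. The set is open, so the agreement
  -- carries over to all derivatives.
  have hfceq : ∀ t x, (t, x) ∈ ErlangMotion.offLines v →
      fc t x = ErlangMotion.waveDensity m v lam t x := fun t x h => hfc.eq hpart h.1 h.2
  refine ⟨(ErlangMotion.contDiffOn_waveDensity m v lam _).congr fun p hp => hfceq p.1 p.2 hp,
    fun t x ht hx => ?_⟩
  have hU := ErlangMotion.isOpen_offLines v
  rw [ErlangMotion.transportOp_iterate_eqOn hU m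
    (ErlangMotion.transportOp_iterate_eqOn hU m hfceq) t x ⟨ht, hx⟩, hfceq t x ⟨ht, hx⟩,
    ErlangMotion.transportOp_iterate_waveDensity hm hv.ne' lam hx, sub_self]
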